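/- **Theorem (Preservation for $F_{<:C}$).** Let $\Gamma$ be an environment, $s,t$ terms and $T$ a qualified type of the calculus $F_{<:C}$ defined below. If $\Gamma\vdash s:T$ and $s\longrightarrow t$, then $\Gamma\vdash t:T$. *Syntax* (up to renaming of bound variables; $x$ ranges over term variables, $X$ over type variables, $Y$ over qualifier variables). - Qualifiers: $P,Q,R ::= \top \mid \bot \mid Y \mid x \mid Q\wedge R \mid Q\vee R$. - Simple types: $S ::= \top \mid X \mid (x:T_1)\to T_2 \mid \forall(X<:S).T \mid \forall(Y<:Q).T$; qualified types: $T,U ::= \{Q\}\,S$. In $(x:T_1)\to T_2$ the variable $x$ is bound in $T_2$, where it may occur as a qualifier. - Terms: $s,t,u ::= x \mid \lambda(x)_P.t \mid s\{Q\}(t) \mid \Lambda(X<:S)_P.t \mid s[S] \mid \Lambda(Y<:Q)_P.t \mid s[Q] \mid \mathsf{assert}\,Q\,s \mid \mathsf{upqual}\,Q\,s$. The binder of $\lambda(x)_P.t$ binds $x$ in $t$ both as a term variable and as a qualifier variable; $P$ is the tag of the abstraction and is outside the scope of its binder. Values $v$ are the three forms of abstraction; $v_P$ denotes a value with tag $P$,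 and $v_Q$ the same value with its tag replaced by $Q$. - Environments: $\Gamma ::= \varnothing \mid \Gamma,x:T \mid \Gamma,X<:S \mid \Gamma,Y<:Q$. All environments, types, qualifiers and terms are well scoped: each entry of an environment uses only variables bound to its left, and in every judgment all free variables are bound in the environment. $\mathrm{fv}(t)$ is the set of term variables that occur free in $t$ in term position (occurrences in qualifiers, tags and types do not count), and $\bigvee_{y\in\varnothing}y=\bot$. *Evaluation.* $\mathrm{eval}$ is the partial map from qualifiers to the lattice $\{\bot\sqsubset\top\}$ that interprets $\top,\bot,\wedge,\vee$ and is undefined on qualifiers containing variables. Reduction $\longrightarrow$ is generated by - $(\lambda(x)_P.t)\{Q\}(v)\longrightarrow t[x\mapsto v,\,x\mapsto Q]$ ($v$ replaces $x$ in term position, $Q$ replaces $x$ in qualifier position); - $(\Lambda(X<:S)_P.t)[S']\longrightarrow t[X\mapsto S']$; $\quad(\Lambda(Y<:Q)_P.t)[Q']\longrightarrow t[Y\mapsto Q']$; - $\mathsf{upqual}\,Q\,v_P\longrightarrow v_Q$ and $\mathsf{assert}\,Q\,v_P\longrightarrow v_P$, if $\mathrm{eval}(P)$ and $\mathrm{eval}(Q)$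 are defined and $\mathrm{eval}(P)\sqsubseteq\mathrm{eval}(Q)$; - $E[s]\longrightarrow E[t]$ if $s\longrightarrow t$, for $E ::= [\,] \mid E\{Q\}(t) \mid v\{Q\}(E) \mid E[S] \mid E[Q] \mid \mathsf{assert}\,Q\,E \mid \mathsf{upqual}\,Q\,E$. *Subqualification* $\Gamma\vdash Q<:R$ is generated by: $Q<:\top$; $\bot<:Q$; $Y<:Y$; $x<:x$; $Y<:R$ if $(Y<:Q)\in\Gamma$ and $Q<:R$; $x<:R$ if $(x:\{Q\}S)\in\Gamma$ and $Q<:R$; $Q<:R_1\vee R_2$ if $Q<:R_1$ or $Q<:R_2$; $Q_1\vee Q_2<:R$ if $Q_1<:R$ and $Q_2<:R$; $Q<:R_1\wedge R_2$ if $Q<:R_1$ and $Q<:R_2$; $Q_1\wedge Q_2<:R$ if $Q_1<:R$ or $Q_2<:R$. *Subtyping* is generated by: $\Gamma\vdash S<:\top$; $\Gamma\vdash X<:X$; $\Gamma\vdash X<:S'$ if $(X<:S)\in\Gamma$ and $\Gamma\vdash S<:S'$; $\Gamma\vdash (x:T_1)\to U_1<:(x:T_2)\to U_2$ if $\Gamma\vdash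 T_2<:T_1$ and $\Gamma,x:T_2\vdash U_1<:U_2$; $\Gamma\vdash\forall(X<:S_1).U_1<:\forall(X<:S_2).U_2$ if $\Gamma\vdash S_2<:S_1$ and $\Gamma,X<:S_2\vdash U_1<:U_2$; $\Gamma\vdash\forall(Y<:Q_1).U_1<:\forall(Y<:Q_2).U_2$ if $\Gamma\vdash Q_2<:Q_1$ and $\Gamma,Y<:Q_2\vdash U_1<:U_2$; $\Gamma\vdash\{Q_1\}S_1<:\{Q_2\}S_2$ if $\Gamma\vdash Q_1<:Q_2$ and $\Gamma\vdash S_1<:S_2$. *Typing* $\Gamma\vdash t:T$ is generated by: - $\Gamma\vdash x:\{x\}S$ if $(x:\{Q\}S)\in\Gamma$; - $\Gamma\vdash\lambda(x)_P.t:\{P\}\,(x:T_1)\to T_2$ if $\Gamma,x:T_1\vdash t:T_2$ and $\Gamma\vdash\bigvee_{y\in\mathrm{fv}(t)\setminus\{x\}}y<:P$; - $\Gamma\vdash\Lambda(X<:S)_P.t:\{P\}\,\forall(X<:S).T$ if $\Gamma,X<:S\vdash t:T$ and $\Gamma\vdash\bigvee_{y\in\mathrm{fv}(t)}y<:P$;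 - $\Gamma\vdash\Lambda(Y<:Q)_P.t:\{P\}\,\forall(Y<:Q).T$ if $\Gamma,Y<:Q\vdash t:T$ and $\Gamma\vdash\bigvee_{y\in\mathrm{fv}(t)}y<:P$; - $\Gamma\vdash s\{Q'\}(t):T[x\mapsto Q']$ if $\Gamma\vdash s:\{R\}\,(x:\{Q\}S)\to T$, $\Gamma\vdash t:\{Q'\}S$ and $\Gamma\vdash Q'<:Q$; - $\Gamma\vdash s[S']:T[X\mapsto S']$ if $\Gamma\vdash s:\{R\}\,\forall(X<:S).T$ and $\Gamma\vdash S'<:S$; - $\Gamma\vdash s[Q']:T[Y\mapsto Q']$ if $\Gamma\vdash s:\{R\}\,\forall(Y<:Q).T$ and $\Gamma\vdash Q'<:Q$; - $\Gamma\vdash\mathsf{assert}\,P\,s:\{Q\}S$ and $\Gamma\vdash\mathsf{upqual}\,P\,s:\{P\}S$, each if $\Gamma\vdash s:\{Q\}S$ and $\Gamma\vdash Q<:P$; - $\Gamma\vdash s:T_2$ if $\Gamma\vdash s:T_1$ and $\Gamma\vdash T_1<:T_2$. -/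

import Mathlib

/-!
The capture-tracking calculus `F<:C`, in well-scoped de Bruijn form.  A *signature* lists the kinds
of the binders in scope (innermost first), and qualifiers, types, terms and environments are indexed
by it; well-formedness of types and environments (every variable is bound to the left of its use)
is therefore built into the syntax.
-/

namespace FsubC

/-- The three kinds of binders: `x : T`, `X <: S` and `Y <: Q`. -/
inductive Kind : Type
  | tm
  | ty
  | qu

abbrev Sig : Type := List Kind

/-- Variables of kind `k` in scope `s`. -/
inductive Var : Sig → Kind → Type
  | here {s : Sig} {k : Kind} : Var (k :: s) k
  | there {s : Sig} {k j : Kind} (x : Var s k) : Var (j :: s) k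

/-- Qualifiers `P, Q, R ::= ⊤ | ⊥ | Y | x | Q ∧ R | Q ∨ R`; a term binder `x` also binds a qualifier
variable of the same name. -/
inductive Qual (s : Sig) : Type
  | top
  | bot
  | qvar (Y : Var s .qu)
  | tvar (x : Var s .tm)
  | meet (Q R : Qual s)
  | join (Q R : Qual s)

inductive TySort : Type
  | simple
  | qualified

/-- Simple types `S ::= ⊤ | X | (x : T₁) → T₂ | ∀(X <: S). T | ∀(Y <: Q). T` and
qualified types `T ::= {Q} S`. In an arrow `(x : T₁) → T₂` the variable `x` may occur in `T₂`,
in qualifier position. -/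
inductive Ty : TySort → Sig → Type
  | top {s : Sig} : Ty .simple s
  | var {s : Sig} (X : Var s .ty) : Ty .simple s
  | arrow {s : Sig} (T₁ : Ty .qualified s) (T₂ : Ty .qualified (.tm :: s)) : Ty .simple s
  | all {s : Sig} (S : Ty .simple s) (T : Ty .qualified (.ty :: s)) : Ty .simple s
  | qall {s : Sig} (Q : Qual s) (T : Ty .qualified (.qu :: s)) : Ty .simple s
  | qtype {s : Sig} (Q : Qual s) (S : Ty .simple s) : Ty .qualified s

/-- Simple types `S`. -/
abbrev STy (s : Sig) : Type := Ty .simple s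

/-- Qualified types `T`. -/
abbrev QTy (s : Sig) : Type := Ty .qualified s

/-- Terms
`s, t ::= x | λ(x)_P. t | s{Q}(t) | Λ(X <: S)_P. t | s[S] | Λ(Y <: Q)_P. t | s[Q]
  | assert Q s | upqual Q s`,
where `P` is the tag of an abstraction. -/
inductive Tm : Sig → Type
  | var {s : Sig} (x : Var s .tm) : Tm s
  | lam {s : Sig} (P : Qual s) (t : Tm (.tm :: s)) : Tm s
  | app {s : Sig} (t : Tm s) (Q : Qual s) (u : Tm s) : Tm s
  | tlam {s : Sig} (P : Qual s) (S : STy s) (t : Tm (.ty :: s)) : Tm s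
  | tapp {s : Sig} (t : Tm s) (S : STy s) : Tm s
  | qlam {s : Sig} (P : Qual s) (Q : Qual s) (t : Tm (.qu :: s)) : Tm s
  | qapp {s : Sig} (t : Tm s) (Q : Qual s) : Tm s
  | assert {s : Sig} (Q : Qual s) (t : Tm s) : Tm s
  | upqual {s : Sig} (Q : Qual s) (t : Tm s) : Tm s

/-! ### Renaming -/

/-- Kind-preserving renamings. -/
abbrev Ren (s s' : Sig) : Type := (k : Kind) → Var s k → Var s' k

def Ren.weak {s : Sig} {j : Kind} : Ren s (j :: s) := fun _ x => .there x

def Ren.lift {s s' : Sig} {j : Kind} (ρ : Ren s s') : Ren (j :: s) (j :: s')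
  | _, .here => .here
  | _, .there x => .there (ρ _ x)

def Qual.rename {s s' : Sig} (ρ : Ren s s') : Qual s → Qual s'
  | .top => .top
  | .bot => .bot
  | .qvar Y => .qvar (ρ _ Y)
  | .tvar x => .tvar (ρ _ x)
  | .meet Q R => .meet (Q.rename ρ) (R.rename ρ)
  | .join Q R => .join (Q.rename ρ) (R.rename ρ)

def Ty.rename {k : TySort} {s s' : Sig} (ρ : Ren s s') : Ty k s → Ty k s'
  | .top => .top
  | .var X => .var (ρ _ X)
  | .arrow T₁ T₂ => .arrow (T₁.rename ρ) (T₂.rename ρ.lift)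
  | .all S T => .all (S.rename ρ) (T.rename ρ.lift)
  | .qall Q T => .qall (Q.rename ρ) (T.rename ρ.lift)
  | .qtype Q S => .qtype (Q.rename ρ) (S.rename ρ)

def Tm.rename {s s' : Sig} (ρ : Ren s s') : Tm s → Tm s'
  | .var x => .var (ρ _ x)
  | .lam P t => .lam (P.rename ρ) (t.rename ρ.lift)
  | .app t Q u => .app (t.rename ρ) (Q.rename ρ) (u.rename ρ)
  | .tlam P S t => .tlam (P.rename ρ) (S.rename ρ) (t.rename ρ.lift)
  | .tapp t S => .tapp (t.rename ρ) (S.rename ρ)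
  | .qlam P Q t => .qlam (P.rename ρ) (Q.rename ρ) (t.rename ρ.lift)
  | .qapp t Q => .qapp (t.rename ρ) (Q.rename ρ)
  | .assert Q t => .assert (Q.rename ρ) (t.rename ρ)
  | .upqual Q t => .upqual (Q.rename ρ) (t.rename ρ)

/-! ### Simultaneous capture-avoiding substitution -/

/-- A substitution for the variables that may occur in types: `qtm` gives the qualifier replacing a
term-bound variable in qualifier position. -/
structure TySubst (s s' : Sig) : Type where
  qtm : Var s .tm → Qual s'
  ty : Var s .ty → STy s'
  qu : Var s .qu → Qual s'

def TySubst.lift {s s' : Sig} {j : Kind} (σ : TySubst s s') : TySubst (j :: s) (j :: s') where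
  qtm x := match j, x with
    | _, .here => .tvar .here
    | _, .there x => (σ.qtm x).rename Ren.weak
  ty X := match j, X with
    | _, .here => .var .here
    | _, .there X => (σ.ty X).rename Ren.weak
  qu Y := match j, Y with
    | _, .here => .qvar .here
    | _, .there Y => (σ.qu Y).rename Ren.weak

def Qual.subst {s s' : Sig} (σ : TySubst s s') : Qual s → Qual s'
  | .top => .top
  | .bot => .bot
  | .qvar Y => σ.qu Y
  | .tvar x => σ.qtm x
  | .meet Q R => .meet (Q.subst σ) (R.subst σ)
  | .join Q R => .join (Q.subst σ) (R.subst σ)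

def Ty.subst {k : TySort} {s s' : Sig} (σ : TySubst s s') : Ty k s → Ty k s'
  | .top => .top
  | .var X => σ.ty X
  | .arrow T₁ T₂ => .arrow (T₁.subst σ) (T₂.subst σ.lift)
  | .all S T => .all (S.subst σ) (T.subst σ.lift)
  | .qall Q T => .qall (Q.subst σ) (T.subst σ.lift)
  | .qtype Q S => .qtype (Q.subst σ) (S.subst σ)

/-- The term component of a substitution: what replaces term variables in term position. -/
abbrev TmSubst (s s' : Sig) : Type := Var s .tm → Tm s'

def TmSubst.lift {s s' : Sig} {j : Kind} (τ : TmSubst s s') : TmSubst (j :: s) (j :: s') :=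
  fun x => match j, x with
    | _, .here => .var .here
    | _, .there x => (τ x).rename Ren.weak

def Tm.subst {s s' : Sig} (σ : TySubst s s') (τ : TmSubst s s') : Tm s → Tm s'
  | .var x => τ x
  | .lam P t => .lam (P.subst σ) (t.subst σ.lift τ.lift)
  | .app t Q u => .app (t.subst σ τ) (Q.subst σ) (u.subst σ τ)
  | .tlam P S t => .tlam (P.subst σ) (S.subst σ) (t.subst σ.lift τ.lift)
  | .tapp t S => .tapp (t.subst σ τ) (S.subst σ)
  | .qlam P Q t => .qlam (P.subst σ) (Q.subst σ) (t.subst σ.lift τ.lift)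
  | .qapp t Q => .qapp (t.subst σ τ) (Q.subst σ)
  | .assert Q t => .assert (Q.subst σ) (t.subst σ τ)
  | .upqual Q t => .upqual (Q.subst σ) (t.subst σ τ)

/-- `[x ↦ Q]` in qualifier position, for the innermost (term) binder `x`. -/
def TySubst.instTm {s : Sig} (Q : Qual s) : TySubst (.tm :: s) s where
  qtm
    | .here => Q
    | .there x => .tvar x
  ty
    | .there X => .var X
  qu
    | .there Y => .qvar Y

/-- `[X ↦ S]`, for the innermost (type) binder `X`. -/
def TySubst.instTy {s : Sig} (S : STy s) : TySubst (.ty :: s) s where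
  qtm
    | .there x => .tvar x
  ty
    | .here => S
    | .there X => .var X
  qu
    | .there Y => .qvar Y

/-- `[Y ↦ Q]`, for the innermost (qualifier) binder `Y`. -/
def TySubst.instQu {s : Sig} (Q : Qual s) : TySubst (.qu :: s) s where
  qtm
    | .there x => .tvar x
  ty
    | .there X => .var X
  qu
    | .here => Q
    | .there Y => .qvar Y

/-- `t[x ↦ v, x ↦ Q]`: the innermost term binder is replaced by `v` in term position and by `Q`
in qualifier position. -/
def Tm.instTm {s : Sig} (t : Tm (.tm :: s)) (Q : Qual s) (v : Tm s) : Tm s :=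
  t.subst (TySubst.instTm Q) fun
    | .here => v
    | .there x => .var x

/-- `t[X ↦ S]`. -/
def Tm.instTy {s : Sig} (t : Tm (.ty :: s)) (S : STy s) : Tm s :=
  t.subst (TySubst.instTy S) fun
    | .there x => .var x

/-- `t[Y ↦ Q]`. -/
def Tm.instQu {s : Sig} (t : Tm (.qu :: s)) (Q : Qual s) : Tm s :=
  t.subst (TySubst.instQu Q) fun
    | .there x => .var x

/-! ### Free variables -/

/-- Undo one weakening; `none` on the variable bound by the innermost binder. -/
def Var.lower {s : Sig} {j k : Kind} : Var (j :: s) k → Option (Var s k)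
  | .here => none
  | .there x => some x

/-- The free term variables of a term (those occurring in term position), listed with
repetitions. -/
def Tm.fv {s : Sig} : Tm s → List (Var s .tm)
  | .var x => [x]
  | .lam _ t => t.fv.filterMap Var.lower
  | .app t _ u => t.fv ++ u.fv
  | .tlam _ _ t => t.fv.filterMap Var.lower
  | .tapp t _ => t.fv
  | .qlam _ _ t => t.fv.filterMap Var.lower
  | .qapp t _ => t.fv
  | .assert _ t => t.fv
  | .upqual _ t => t.fv

/-- The qualifier `⋁_{y ∈ l} y`; the empty join is `⊥`. -/
def joinVars {s : Sig} : List (Var s .tm) → Qual s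
  | [] => .bot
  | x :: l => .join (.tvar x) (joinVars l)

/-! ### Evaluation -/

/-- Evaluation of a qualifier to an element of the two-point lattice (`⊥ = false < true = ⊤`);
undefined on a qualifier that contains variables. -/
def Qual.eval {s : Sig} : Qual s → Option Bool
  | .top => some true
  | .bot => some false
  | .qvar _ => none
  | .tvar _ => none
  | .meet Q R => do
      let a ← Q.eval
      let b ← R.eval
      return a ⊓ b
  | .join Q R => do
      let a ← Q.eval
      let b ← R.eval
      return a ⊔ b

/-- `eval P` and `eval Q` are both defined and `eval P ⊑ eval Q`. -/
def EvalLE {s : Sig} (P Q : Qual s) : Prop :=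
  ∃ a b : Bool, P.eval = some a ∧ Q.eval = some b ∧ a ≤ b

/-- `Value P v`: the term `v` is a value (an abstraction) with tag `P`. -/
inductive Value {s : Sig} : Qual s → Tm s → Prop
  | lam (P : Qual s) (t : Tm (.tm :: s)) : Value P (.lam P t)
  | tlam (P : Qual s) (S : STy s) (t : Tm (.ty :: s)) : Value P (.tlam P S t)
  | qlam (P Q : Qual s) (t : Tm (.qu :: s)) : Value P (.qlam P Q t)

/-- Replace the tag of a value by `Q` (the identity on other terms). -/
def Tm.retag {s : Sig} (Q : Qual s) : Tm s → Tm s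
  | .lam _ t => .lam Q t
  | .tlam _ S t => .tlam Q S t
  | .qlam _ R t => .qlam Q R t
  | t => t

/-- Call-by-value reduction `s ⟶ t`, closed under the evaluation contexts
`E ::= [] | E{Q}(t) | v{Q}(E) | E[S] | E[Q] | assert Q E | upqual Q E`. -/
inductive Step {s : Sig} : Tm s → Tm s → Prop
  | beta_v {P Q R : Qual s} {t : Tm (.tm :: s)} {v : Tm s} :
      Value R v → Step (.app (.lam P t) Q v) (t.instTm Q v)
  | beta_T {P : Qual s} {S S' : STy s} {t : Tm (.ty :: s)} :
      Step (.tapp (.tlam P S t) S') (t.instTy S')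
  | beta_Q {P Q Q' : Qual s} {t : Tm (.qu :: s)} :
      Step (.qapp (.qlam P Q t) Q') (t.instQu Q')
  | upqual {P Q : Qual s} {v : Tm s} :
      Value P v → EvalLE P Q → Step (.upqual Q v) (v.retag Q)
  | assert {P Q : Qual s} {v : Tm s} :
      Value P v → EvalLE P Q → Step (.assert Q v) v
  | app_fun {t t' : Tm s} {Q : Qual s} {u : Tm s} :
      Step t t' → Step (.app t Q u) (.app t' Q u)
  | app_arg {R : Qual s} {v : Tm s} {Q : Qual s} {u u' : Tm s} :
      Value R v → Step u u' → Step (.app v Q u) (.app v Q u')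
  | tapp {t t' : Tm s} {S : STy s} : Step t t' → Step (.tapp t S) (.tapp t' S)
  | qapp {t t' : Tm s} {Q : Qual s} : Step t t' → Step (.qapp t Q) (.qapp t' Q)
  | assert_ctx {t t' : Tm s} {Q : Qual s} : Step t t' → Step (.assert Q t) (.assert Q t')
  | upqual_ctx {t t' : Tm s} {Q : Qual s} : Step t t' → Step (.upqual Q t) (.upqual Q t')

/-! ### Environments -/

/-- What an environment records for a variable of each kind: `x : T`, `X <: S` or `Y <: Q`. -/
inductive Binding : Kind → Sig → Type
  | tm {s : Sig} (T : QTy s) : Binding .tm s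
  | ty {s : Sig} (S : STy s) : Binding .ty s
  | qu {s : Sig} (Q : Qual s) : Binding .qu s

def Binding.rename {k : Kind} {s s' : Sig} (ρ : Ren s s') : Binding k s → Binding k s'
  | .tm T => .tm (T.rename ρ)
  | .ty S => .ty (S.rename ρ)
  | .qu Q => .qu (Q.rename ρ)

/-- Environments `Γ ::= ∅ | Γ, x : T | Γ, X <: S | Γ, Y <: Q`. -/
inductive Ctx : Sig → Type
  | nil : Ctx []
  | cons {s : Sig} {k : Kind} (Γ : Ctx s) (b : Binding k s) : Ctx (k :: s)

def Ctx.lookup {s : Sig} {k : Kind} : Ctx s → Var s k → Binding k s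
  | .cons _ b, .here => b.rename Ren.weak
  | .cons Γ _, .there x => (Γ.lookup x).rename Ren.weak

/-! ### Subqualification, subtyping, typing -/

/-- Subqualification `Γ ⊢ Q <: R`. -/
inductive SubQual {s : Sig} (Γ : Ctx s) : Qual s → Qual s → Prop
  | top {Q : Qual s} : SubQual Γ Q .top
  | bot {Q : Qual s} : SubQual Γ .bot Q
  | refl_var {Y : Var s .qu} : SubQual Γ (.qvar Y) (.qvar Y)
  | var {Y : Var s .qu} {Q R : Qual s} :
      Γ.lookup Y = .qu Q → SubQual Γ Q R → SubQual Γ (.qvar Y) R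
  | refl_tvar {x : Var s .tm} : SubQual Γ (.tvar x) (.tvar x)
  | tvar {x : Var s .tm} {Q R : Qual s} {S : STy s} :
      Γ.lookup x = .tm (.qtype Q S) → SubQual Γ Q R → SubQual Γ (.tvar x) R
  | join_intro_1 {Q R₁ R₂ : Qual s} : SubQual Γ Q R₁ → SubQual Γ Q (.join R₁ R₂)
  | join_intro_2 {Q R₁ R₂ : Qual s} : SubQual Γ Q R₂ → SubQual Γ Q (.join R₁ R₂)
  | join_elim {Q₁ Q₂ R : Qual s} :
      SubQual Γ Q₁ R → SubQual Γ Q₂ R → SubQual Γ (.join Q₁ Q₂) R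
  | meet_intro {Q R₁ R₂ : Qual s} :
      SubQual Γ Q R₁ → SubQual Γ Q R₂ → SubQual Γ Q (.meet R₁ R₂)
  | meet_elim_1 {Q₁ Q₂ R : Qual s} : SubQual Γ Q₁ R → SubQual Γ (.meet Q₁ Q₂) R
  | meet_elim_2 {Q₁ Q₂ R : Qual s} : SubQual Γ Q₂ R → SubQual Γ (.meet Q₁ Q₂) R

/-- Subtyping `Γ ⊢ S₁ <: S₂` of simple types and `Γ ⊢ T₁ <: T₂` of qualified types. -/
inductive Sub : {s : Sig} → Ctx s → {k : TySort} → Ty k s → Ty k s → Prop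
  | top {s : Sig} {Γ : Ctx s} {S : STy s} : Sub Γ S .top
  | refl_var {s : Sig} {Γ : Ctx s} {X : Var s .ty} : Sub Γ (.var X) (.var X)
  | var {s : Sig} {Γ : Ctx s} {X : Var s .ty} {S S' : STy s} :
      Γ.lookup X = .ty S → Sub Γ S S' → Sub Γ (.var X) S'
  | arrow {s : Sig} {Γ : Ctx s} {T₁ T₂ : QTy s} {U₁ U₂ : QTy (.tm :: s)} :
      Sub Γ T₂ T₁ → Sub (Γ.cons (.tm T₂)) U₁ U₂ → Sub Γ (.arrow T₁ U₁) (.arrow T₂ U₂)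
  | all {s : Sig} {Γ : Ctx s} {S₁ S₂ : STy s} {U₁ U₂ : QTy (.ty :: s)} :
      Sub Γ S₂ S₁ → Sub (Γ.cons (.ty S₂)) U₁ U₂ → Sub Γ (.all S₁ U₁) (.all S₂ U₂)
  | qall {s : Sig} {Γ : Ctx s} {Q₁ Q₂ : Qual s} {U₁ U₂ : QTy (.qu :: s)} :
      SubQual Γ Q₂ Q₁ → Sub (Γ.cons (.qu Q₂)) U₁ U₂ → Sub Γ (.qall Q₁ U₁) (.qall Q₂ U₂)
  | qtype {s : Sig} {Γ : Ctx s} {Q₁ Q₂ : Qual s} {S₁ S₂ : STy s} :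
      SubQual Γ Q₁ Q₂ → Sub Γ S₁ S₂ → Sub Γ (.qtype Q₁ S₁) (.qtype Q₂ S₂)

/-- Typing `Γ ⊢ t : T`. The rules for abstractions check that the tag super-qualifies the join of
the free variables of the abstraction. -/
inductive HasType : {s : Sig} → Ctx s → Tm s → QTy s → Prop
  | var {s : Sig} {Γ : Ctx s} {x : Var s .tm} {Q : Qual s} {S : STy s} :
      Γ.lookup x = .tm (.qtype Q S) → HasType Γ (.var x) (.qtype (.tvar x) S)
  | abs {s : Sig} {Γ : Ctx s} {P : Qual s} {T₁ : QTy s} {t : Tm (.tm :: s)}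
      {T₂ : QTy (.tm :: s)} :
      HasType (Γ.cons (.tm T₁)) t T₂ →
      SubQual Γ (joinVars (Tm.lam P t).fv) P →
      HasType Γ (.lam P t) (.qtype P (.arrow T₁ T₂))
  | t_abs {s : Sig} {Γ : Ctx s} {P : Qual s} {S : STy s} {t : Tm (.ty :: s)}
      {T : QTy (.ty :: s)} :
      HasType (Γ.cons (.ty S)) t T →
      SubQual Γ (joinVars (Tm.tlam P S t).fv) P →
      HasType Γ (.tlam P S t) (.qtype P (.all S T))
  | q_abs {s : Sig} {Γ : Ctx s} {P Q : Qual s} {t : Tm (.qu :: s)} {T : QTy (.qu :: s)} :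
      HasType (Γ.cons (.qu Q)) t T →
      SubQual Γ (joinVars (Tm.qlam P Q t).fv) P →
      HasType Γ (.qlam P Q t) (.qtype P (.qall Q T))
  | app {s : Sig} {Γ : Ctx s} {t u : Tm s} {R Q Q' : Qual s} {S : STy s}
      {T : QTy (.tm :: s)} :
      HasType Γ t (.qtype R (.arrow (.qtype Q S) T)) →
      HasType Γ u (.qtype Q' S) →
      SubQual Γ Q' Q →
      HasType Γ (.app t Q' u) (T.subst (TySubst.instTm Q'))
  | t_app {s : Sig} {Γ : Ctx s} {t : Tm s} {R : Qual s} {S S' : STy s}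
      {T : QTy (.ty :: s)} :
      HasType Γ t (.qtype R (.all S T)) →
      Sub Γ S' S →
      HasType Γ (.tapp t S') (T.subst (TySubst.instTy S'))
  | q_app {s : Sig} {Γ : Ctx s} {t : Tm s} {R Q Q' : Qual s} {T : QTy (.qu :: s)} :
      HasType Γ t (.qtype R (.qall Q T)) →
      SubQual Γ Q' Q →
      HasType Γ (.qapp t Q') (T.subst (TySubst.instQu Q'))
  | assert {s : Sig} {Γ : Ctx s} {t : Tm s} {P Q : Qual s} {S : STy s} :
      HasType Γ t (.qtype Q S) → SubQual Γ Q P → HasType Γ (.assert P t) (.qtype Q S)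
  | upqual {s : Sig} {Γ : Ctx s} {t : Tm s} {P Q : Qual s} {S : STy s} :
      HasType Γ t (.qtype Q S) → SubQual Γ Q P → HasType Γ (.upqual P t) (.qtype P S)
  | sub {s : Sig} {Γ : Ctx s} {t : Tm s} {T T' : QTy s} :
      HasType Γ t T → Sub Γ T T' → HasType Γ t T'

end FsubC

namespace FsubC

/-! ### Substitution algebra -/

/-! Preservation is an induction on the typing derivation with a case analysis on the step. In a β
case, inversion (`HasType.lam_inv` and its analogues) types the body under the abstraction's own
binder, the substitution lemma `HasType.subst` instantiates it, and `Sub.subst` relates the result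
to the expected type.

The point specific to capture tracking is that substituting `v` for `x` puts the free variables of
`v` inside abstractions whose tags were only checked against `x`. If such a tag `P` is above `x`,
then `P[x ↦ Q']` is above `Q'`, so it suffices that `Q'` be above the free variables of `v`. This is
where call-by-value enters: the tag of a value is above its free variables and below the qualifier
of any of its types (`HasType.value_fv`). The same fact lets `upqual` raise a tag.

Neither subqualification nor subtyping has a transitivity rule, yet inversion and substitution need
transitivity. For qualifiers it is a cut elimination (`SubQual.trans`). For types, transitivity
under binders needs narrowing, and narrowing a type variable needs transitivity at its bound. The
circle is broken by a substitution lemma whose hypothesis `TySubst.Typed` asks, at each type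
variable, only for the instance of transitivity that is used. Narrowing is then substitution by the
identity, and transitivity follows by induction on the middle type (`transThrough`). -/

theorem TySubst.ext' {s s' : Sig} {σ σ' : TySubst s s'} (h₁ : ∀ x, σ.qtm x = σ'.qtm x)
    (h₂ : ∀ X, σ.ty X = σ'.ty X) (h₃ : ∀ Y, σ.qu Y = σ'.qu Y) : σ = σ' := by
  cases σ
  cases σ'
  congr 1
  · exact funext h₁
  · exact funext h₂
  · exact funext h₃

/-- A renaming seen as a substitution. -/
def TySubst.ofRen {s s' : Sig} (ρ : Ren s s') : TySubst s s' where
  qtm x := .tvar (ρ _ x)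
  ty X := .var (ρ _ X)
  qu Y := .qvar (ρ _ Y)

/-- Rename first, then substitute. -/
def TySubst.precomp {s s' s'' : Sig} (σ : TySubst s' s'') (ρ : Ren s s') : TySubst s s'' where
  qtm x := σ.qtm (ρ _ x)
  ty X := σ.ty (ρ _ X)
  qu Y := σ.qu (ρ _ Y)

/-- Substitute with `σ` first, then with `σ'`. -/
def TySubst.comp {s s' s'' : Sig} (σ : TySubst s s') (σ' : TySubst s' s'') : TySubst s s'' where
  qtm x := (σ.qtm x).subst σ'
  ty X := (σ.ty X).subst σ'
  qu Y := (σ.qu Y).subst σ'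

/-- The identity substitution. -/
def TySubst.id {s : Sig} : TySubst s s := TySubst.ofRen fun _ x => x

theorem TySubst.ofRen_lift {s s' : Sig} {j : Kind} (ρ : Ren s s') :
    (TySubst.ofRen ρ).lift (j := j) = TySubst.ofRen ρ.lift := by
  apply TySubst.ext' <;> intro x <;> cases x <;> rfl

theorem Qual.rename_eq_subst {s s' : Sig} (ρ : Ren s s') (Q : Qual s) :
    Q.rename ρ = Q.subst (TySubst.ofRen ρ) := by
  induction Q <;> simp_all [Qual.rename, Qual.subst, TySubst.ofRen]

theorem Ty.rename_eq_subst {k : TySort} {s : Sig} (T : Ty k s) :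
    ∀ {s' : Sig} (ρ : Ren s s'), T.rename ρ = T.subst (TySubst.ofRen ρ) := by
  induction T <;> intro s' ρ <;>
    simp_all [Ty.rename, Ty.subst, TySubst.ofRen_lift, Qual.rename_eq_subst]
  rfl

theorem TySubst.precomp_lift {s s' s'' : Sig} {j : Kind} (σ : TySubst s' s'') (ρ : Ren s s') :
    (σ.precomp ρ).lift (j := j) = σ.lift.precomp ρ.lift := by
  apply TySubst.ext' <;> intro x <;> cases x <;> rfl

theorem Qual.subst_rename {s s' s'' : Sig} (ρ : Ren s s') (σ : TySubst s' s'') (Q : Qual s) :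
    (Q.rename ρ).subst σ = Q.subst (σ.precomp ρ) := by
  induction Q <;> simp_all [Qual.rename, Qual.subst, TySubst.precomp]

theorem Ty.subst_rename {k : TySort} {s : Sig} (T : Ty k s) :
    ∀ {s' s'' : Sig} (ρ : Ren s s') (σ : TySubst s' s''),
      (T.rename ρ).subst σ = T.subst (σ.precomp ρ) := by
  induction T <;> intro s' s'' ρ σ <;>
    simp_all [Ty.rename, Ty.subst, TySubst.precomp_lift, Qual.subst_rename]
  rfl

theorem Qual.rename_rename {s s' s'' : Sig} (ρ : Ren s s') (ρ' : Ren s' s'') (Q : Qual s) :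
    (Q.rename ρ).rename ρ' = Q.rename fun k x => ρ' k (ρ k x) := by
  rw [Qual.rename_eq_subst ρ', Qual.subst_rename, Qual.rename_eq_subst]
  rfl

theorem Ty.rename_rename {k : TySort} {s s' s'' : Sig} (ρ : Ren s s') (ρ' : Ren s' s'')
    (T : Ty k s) : (T.rename ρ).rename ρ' = T.rename fun k x => ρ' k (ρ k x) := by
  rw [Ty.rename_eq_subst _ ρ', Ty.subst_rename, Ty.rename_eq_subst]
  rfl

theorem Qual.rename_weak_comm {s s' : Sig} {j : Kind} (ρ : Ren s s') (Q : Qual s) :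
    (Q.rename ρ).rename (Ren.weak (j := j)) = (Q.rename Ren.weak).rename ρ.lift := by
  simp only [Qual.rename_rename]
  rfl

theorem Ty.rename_weak_comm {k : TySort} {s s' : Sig} {j : Kind} (ρ : Ren s s') (T : Ty k s) :
    (T.rename ρ).rename (Ren.weak (j := j)) = (T.rename Ren.weak).rename ρ.lift := by
  simp only [Ty.rename_rename]
  rfl

theorem TySubst.comp_ofRen_lift {s s' s'' : Sig} {j : Kind} (σ : TySubst s s') (ρ : Ren s' s'') :
    (σ.comp (TySubst.ofRen ρ)).lift (j := j) = σ.lift.comp (TySubst.ofRen ρ.lift) := by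
  apply TySubst.ext' <;> intro x <;> cases x <;>
    simp only [TySubst.comp, TySubst.lift, ← Qual.rename_eq_subst, ← Ty.rename_eq_subst,
      Qual.rename_weak_comm, Ty.rename_weak_comm] <;> rfl

theorem Qual.subst_subst {s s' s'' : Sig} (σ : TySubst s s') (σ' : TySubst s' s'') (Q : Qual s) :
    (Q.subst σ).subst σ' = Q.subst (σ.comp σ') := by
  induction Q <;> simp_all [Qual.subst, TySubst.comp]

theorem Ty.rename_subst {k : TySort} {s : Sig} (T : Ty k s) :
    ∀ {s' s'' : Sig} (σ : TySubst s s') (ρ : Ren s' s''),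
      (T.subst σ).rename ρ = T.subst (σ.comp (TySubst.ofRen ρ)) := by
  induction T <;> intro s' s'' σ ρ <;>
    simp_all [Ty.rename, Ty.subst, TySubst.comp_ofRen_lift, Qual.rename_eq_subst,
      Qual.subst_subst]
  simp [TySubst.comp, Ty.rename_eq_subst]

theorem Qual.subst_weak_comm {s s' : Sig} {j : Kind} (σ : TySubst s s') (Q : Qual s) :
    (Q.rename (Ren.weak (j := j))).subst σ.lift = (Q.subst σ).rename Ren.weak := by
  rw [Qual.subst_rename, Qual.rename_eq_subst, Qual.subst_subst]
  congr 1
  apply TySubst.ext' <;> intro x <;>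
    simp only [TySubst.comp, TySubst.precomp, ← Qual.rename_eq_subst, ← Ty.rename_eq_subst] <;> rfl

theorem Ty.subst_weak_comm {k : TySort} {s s' : Sig} {j : Kind} (σ : TySubst s s') (T : Ty k s) :
    (T.rename (Ren.weak (j := j))).subst σ.lift = (T.subst σ).rename Ren.weak := by
  rw [Ty.subst_rename, Ty.rename_subst]
  congr 1
  apply TySubst.ext' <;> intro x <;>
    simp only [TySubst.comp, TySubst.precomp, ← Qual.rename_eq_subst, ← Ty.rename_eq_subst] <;> rfl

/-- Last stage of a ladder: substitution after renaming, renaming after substitution, then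
substitution after substitution. At each stage the composite must commute with `lift`; here this is
the commutation of weakening with substitution, obtained from the two earlier stages. -/
theorem TySubst.comp_lift {s s' s'' : Sig} {j : Kind} (σ : TySubst s s') (σ' : TySubst s' s'') :
    (σ.comp σ').lift (j := j) = σ.lift.comp σ'.lift := by
  apply TySubst.ext' <;> intro x <;> cases x <;>
    first
      | rfl
      | exact (Qual.subst_weak_comm _ _).symm
      | exact (Ty.subst_weak_comm _ _).symm

theorem Ty.subst_subst {k : TySort} {s : Sig} (T : Ty k s) :
    ∀ {s' s'' : Sig} (σ : TySubst s s') (σ' : TySubst s' s''),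
      (T.subst σ).subst σ' = T.subst (σ.comp σ') := by
  induction T <;> intro s' s'' σ σ' <;>
    simp_all [Ty.subst, TySubst.comp_lift, Qual.subst_subst]
  rfl

theorem TySubst.id_lift {s : Sig} {j : Kind} :
    (TySubst.id (s := s)).lift (j := j) = TySubst.id := by
  apply TySubst.ext' <;> intro x <;> cases x <;> rfl

theorem Qual.subst_id {s : Sig} (Q : Qual s) : Q.subst TySubst.id = Q := by
  induction Q <;> simp_all [Qual.subst, TySubst.id, TySubst.ofRen]

theorem Ty.subst_id {k : TySort} {s : Sig} (T : Ty k s) : T.subst TySubst.id = T := by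
  induction T <;> simp_all [Ty.subst, TySubst.id_lift, Qual.subst_id]
  rfl

theorem Qual.rename_id {s : Sig} (Q : Qual s) : (Q.rename fun _ x => x) = Q :=
  (Qual.rename_eq_subst _ Q).trans Q.subst_id

theorem Ty.rename_id {k : TySort} {s : Sig} (T : Ty k s) : (T.rename fun _ x => x) = T :=
  (Ty.rename_eq_subst T _).trans T.subst_id

theorem Qual.weak_instTm {s : Sig} (Q R : Qual s) :
    (Q.rename Ren.weak).subst (TySubst.instTm R) = Q :=
  (Qual.subst_rename _ _ _).trans Q.subst_id

theorem Qual.weak_instTy {s : Sig} (Q : Qual s) (S : STy s) :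
    (Q.rename Ren.weak).subst (TySubst.instTy S) = Q :=
  (Qual.subst_rename _ _ _).trans Q.subst_id

theorem Qual.weak_instQu {s : Sig} (Q R : Qual s) :
    (Q.rename Ren.weak).subst (TySubst.instQu R) = Q :=
  (Qual.subst_rename _ _ _).trans Q.subst_id

theorem Ty.weak_instTm {k : TySort} {s : Sig} (T : Ty k s) (R : Qual s) :
    (T.rename Ren.weak).subst (TySubst.instTm R) = T :=
  (Ty.subst_rename _ _ _).trans T.subst_id

theorem Ty.weak_instTy {k : TySort} {s : Sig} (T : Ty k s) (S : STy s) :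
    (T.rename Ren.weak).subst (TySubst.instTy S) = T :=
  (Ty.subst_rename _ _ _).trans T.subst_id

theorem Ty.weak_instQu {k : TySort} {s : Sig} (T : Ty k s) (R : Qual s) :
    (T.rename Ren.weak).subst (TySubst.instQu R) = T :=
  (Ty.subst_rename _ _ _).trans T.subst_id

/-- Both sides are single substitutions by `Ty.subst_subst`, so it is enough to compare them on
variables. This is what makes the dependent result types of the application rules stable under
substitution. -/
theorem Ty.subst_instTm {k : TySort} {s s' : Sig} (T : Ty k (.tm :: s)) (Q : Qual s)
    (σ : TySubst s s') :
    (T.subst (TySubst.instTm Q)).subst σ = (T.subst σ.lift).subst (TySubst.instTm (Q.subst σ)) := by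
  rw [Ty.subst_subst, Ty.subst_subst]
  congr 1
  apply TySubst.ext' <;> intro x <;> cases x <;>
    simp only [TySubst.comp, TySubst.lift, Qual.weak_instTm, Ty.weak_instTm] <;> rfl

theorem Ty.subst_instTy {k : TySort} {s s' : Sig} (T : Ty k (.ty :: s)) (S : STy s)
    (σ : TySubst s s') :
    (T.subst (TySubst.instTy S)).subst σ = (T.subst σ.lift).subst (TySubst.instTy (S.subst σ)) := by
  rw [Ty.subst_subst, Ty.subst_subst]
  congr 1
  apply TySubst.ext' <;> intro x <;> cases x <;>
    simp only [TySubst.comp, TySubst.lift, Qual.weak_instTy, Ty.weak_instTy] <;> rfl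

theorem Ty.subst_instQu {k : TySort} {s s' : Sig} (T : Ty k (.qu :: s)) (Q : Qual s)
    (σ : TySubst s s') :
    (T.subst (TySubst.instQu Q)).subst σ = (T.subst σ.lift).subst (TySubst.instQu (Q.subst σ)) := by
  rw [Ty.subst_subst, Ty.subst_subst]
  congr 1
  apply TySubst.ext' <;> intro x <;> cases x <;>
    simp only [TySubst.comp, TySubst.lift, Qual.weak_instQu, Ty.weak_instQu] <;> rfl

theorem Ty.rename_instTm {k : TySort} {s s' : Sig} (T : Ty k (.tm :: s)) (Q : Qual s)
    (ρ : Ren s s') :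
    (T.subst (TySubst.instTm Q)).rename ρ =
      (T.rename ρ.lift).subst (TySubst.instTm (Q.rename ρ)) := by
  simp only [Ty.rename_eq_subst, Qual.rename_eq_subst, ← TySubst.ofRen_lift, Ty.subst_instTm]

theorem Ty.rename_instTy {k : TySort} {s s' : Sig} (T : Ty k (.ty :: s)) (S : STy s)
    (ρ : Ren s s') :
    (T.subst (TySubst.instTy S)).rename ρ =
      (T.rename ρ.lift).subst (TySubst.instTy (S.rename ρ)) := by
  simp only [Ty.rename_eq_subst, ← TySubst.ofRen_lift, Ty.subst_instTy]

theorem Ty.rename_instQu {k : TySort} {s s' : Sig} (T : Ty k (.qu :: s)) (Q : Qual s)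
    (ρ : Ren s s') :
    (T.subst (TySubst.instQu Q)).rename ρ =
      (T.rename ρ.lift).subst (TySubst.instQu (Q.rename ρ)) := by
  simp only [Ty.rename_eq_subst, Qual.rename_eq_subst, ← TySubst.ofRen_lift, Ty.subst_instQu]

/-! ### Bindings and environments -/

def Binding.subst {k : Kind} {s s' : Sig} (σ : TySubst s s') : Binding k s → Binding k s'
  | .tm T => .tm (T.subst σ)
  | .ty S => .ty (S.subst σ)
  | .qu Q => .qu (Q.subst σ)

theorem Binding.rename_weak_comm {k : Kind} {s s' : Sig} {j : Kind} (ρ : Ren s s')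
    (b : Binding k s) :
    (b.rename ρ).rename (Ren.weak (j := j)) = (b.rename Ren.weak).rename ρ.lift := by
  cases b <;> simp [Binding.rename, Ty.rename_weak_comm, Qual.rename_weak_comm]

theorem Binding.rename_rename {k : Kind} {s s' s'' : Sig} (ρ : Ren s s') (ρ' : Ren s' s'')
    (b : Binding k s) : (b.rename ρ).rename ρ' = b.rename fun k x => ρ' k (ρ k x) := by
  cases b <;> simp [Binding.rename, Ty.rename_rename, Qual.rename_rename]

theorem Binding.rename_id {k : Kind} {s : Sig} (b : Binding k s) : (b.rename fun _ x => x) = b := by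
  cases b <;> simp [Binding.rename, Ty.rename_id, Qual.rename_id]

/-- `ρ` maps each variable of `Γ` to one with the same (renamed) binding in `Δ`. -/
def Ren.Typed {s s' : Sig} (ρ : Ren s s') (Γ : Ctx s) (Δ : Ctx s') : Prop :=
  ∀ k (x : Var s k), Δ.lookup (ρ k x) = (Γ.lookup x).rename ρ

theorem Ren.Typed.lift {s s' : Sig} {ρ : Ren s s'} {Γ : Ctx s} {Δ : Ctx s'} (h : ρ.Typed Γ Δ)
    {k : Kind} (b : Binding k s) : ρ.lift.Typed (Γ.cons b) (Δ.cons (b.rename ρ)) := by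
  intro j x
  cases x with
  | here => exact Binding.rename_weak_comm ρ b
  | there x =>
    refine (congrArg (Binding.rename Ren.weak) (h j x)).trans ?_
    exact Binding.rename_weak_comm ρ _

theorem Ren.Typed.weak {s : Sig} (Γ : Ctx s) {k : Kind} (b : Binding k s) :
    Ren.Typed Ren.weak Γ (Γ.cons b) := fun _ _ => rfl

theorem Ren.Typed.id {s : Sig} (Γ : Ctx s) : Ren.Typed (fun _ x => x) Γ Γ :=
  fun _ _ => (Binding.rename_id _).symm

theorem Ren.Typed.comp {s s' s'' : Sig} {ρ : Ren s s'} {ρ' : Ren s' s''} {Γ : Ctx s} {Δ : Ctx s'}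
    {Θ : Ctx s''} (h : ρ.Typed Γ Δ) (h' : ρ'.Typed Δ Θ) :
    Ren.Typed (fun k x => ρ' k (ρ k x)) Γ Θ := by
  intro k x
  rw [h', h, Binding.rename_rename]

/-! ### Subqualification -/

theorem SubQual.refl {s : Sig} {Γ : Ctx s} (Q : Qual s) : SubQual Γ Q Q := by
  induction Q with
  | top => exact .top
  | bot => exact .bot
  | qvar Y => exact .refl_var
  | tvar x => exact .refl_tvar
  | meet Q R hQ hR => exact .meet_intro (.meet_elim_1 hQ) (.meet_elim_2 hR)
  | join Q R hQ hR => exact .join_elim (.join_intro_1 hQ) (.join_intro_2 hR)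

/-- This lemma and the next three invert the rules for the connectives: `⊤` and joins on the left,
meets and `⊥` on the right. They are the principal cases of the cut elimination below. -/
theorem SubQual.of_top {s : Sig} {Γ : Ctx s} {P R : Qual s} (h : SubQual Γ .top R) :
    SubQual Γ P R := by
  generalize hQ : Qual.top = Q at h
  induction h with
  | top => exact .top
  | join_intro_1 _ ih => exact .join_intro_1 (ih hQ)
  | join_intro_2 _ ih => exact .join_intro_2 (ih hQ)
  | meet_intro _ _ ih₁ ih₂ => exact .meet_intro (ih₁ hQ) (ih₂ hQ)
  | _ => cases hQ

theorem SubQual.of_join {s : Sig} {Γ : Ctx s} {Q₁ Q₂ R : Qual s}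
    (h : SubQual Γ (.join Q₁ Q₂) R) : SubQual Γ Q₁ R ∧ SubQual Γ Q₂ R := by
  generalize hQ : Qual.join Q₁ Q₂ = Q at h
  induction h with
  | top => exact ⟨.top, .top⟩
  | join_intro_1 _ ih => exact ⟨.join_intro_1 (ih hQ).1, .join_intro_1 (ih hQ).2⟩
  | join_intro_2 _ ih => exact ⟨.join_intro_2 (ih hQ).1, .join_intro_2 (ih hQ).2⟩
  | meet_intro _ _ ih₁ ih₂ =>
    exact ⟨.meet_intro (ih₁ hQ).1 (ih₂ hQ).1, .meet_intro (ih₁ hQ).2 (ih₂ hQ).2⟩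
  | join_elim h₁ h₂ => cases hQ; exact ⟨h₁, h₂⟩
  | _ => cases hQ

theorem SubQual.to_meet {s : Sig} {Γ : Ctx s} {Q R₁ R₂ : Qual s}
    (h : SubQual Γ Q (.meet R₁ R₂)) : SubQual Γ Q R₁ ∧ SubQual Γ Q R₂ := by
  generalize hR : Qual.meet R₁ R₂ = R at h
  induction h with
  | bot => exact ⟨.bot, .bot⟩
  | var hl _ ih => exact ⟨.var hl (ih hR).1, .var hl (ih hR).2⟩
  | tvar hl _ ih => exact ⟨.tvar hl (ih hR).1, .tvar hl (ih hR).2⟩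
  | join_elim _ _ ih₁ ih₂ =>
    exact ⟨.join_elim (ih₁ hR).1 (ih₂ hR).1, .join_elim (ih₁ hR).2 (ih₂ hR).2⟩
  | meet_elim_1 _ ih => exact ⟨.meet_elim_1 (ih hR).1, .meet_elim_1 (ih hR).2⟩
  | meet_elim_2 _ ih => exact ⟨.meet_elim_2 (ih hR).1, .meet_elim_2 (ih hR).2⟩
  | meet_intro h₁ h₂ => cases hR; exact ⟨h₁, h₂⟩
  | _ => cases hR

theorem SubQual.to_bot {s : Sig} {Γ : Ctx s} {Q R : Qual s} (h : SubQual Γ Q .bot) :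
    SubQual Γ Q R := by
  generalize hP : Qual.bot = P at h
  induction h with
  | bot => exact .bot
  | var hl _ ih => exact .var hl (ih hP)
  | tvar hl _ ih => exact .tvar hl (ih hP)
  | join_elim _ _ ih₁ ih₂ => exact .join_elim (ih₁ hP) (ih₂ hP)
  | meet_elim_1 _ ih => exact .meet_elim_1 (ih hP)
  | meet_elim_2 _ ih => exact .meet_elim_2 (ih hP)
  | _ => cases hP

/-- Induction on the middle qualifier. For a variable or a join, the left derivation is followed
down to where that qualifier is introduced on the right; for a meet, the right derivation is
followed down to where it is eliminated. The cut then moves to a smaller qualifier or disappears. -/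
theorem SubQual.trans {s : Sig} {Γ : Ctx s} {P Q R : Qual s} (h₁ : SubQual Γ P Q)
    (h₂ : SubQual Γ Q R) : SubQual Γ P R := by
  induction Q generalizing P R with
  | top => exact h₂.of_top
  | bot => exact h₁.to_bot
  | qvar Y =>
    generalize hQ : Qual.qvar Y = Q at h₁
    induction h₁ with
    | bot => exact .bot
    | refl_var => cases hQ; exact h₂
    | var hl _ ih => exact .var hl (ih hQ)
    | tvar hl _ ih => exact .tvar hl (ih hQ)
    | join_elim _ _ ih₁ ih₂ => exact .join_elim (ih₁ hQ) (ih₂ hQ)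
    | meet_elim_1 _ ih => exact .meet_elim_1 (ih hQ)
    | meet_elim_2 _ ih => exact .meet_elim_2 (ih hQ)
    | _ => cases hQ
  | tvar x =>
    generalize hQ : Qual.tvar x = Q at h₁
    induction h₁ with
    | bot => exact .bot
    | refl_tvar => cases hQ; exact h₂
    | var hl _ ih => exact .var hl (ih hQ)
    | tvar hl _ ih => exact .tvar hl (ih hQ)
    | join_elim _ _ ih₁ ih₂ => exact .join_elim (ih₁ hQ) (ih₂ hQ)
    | meet_elim_1 _ ih => exact .meet_elim_1 (ih hQ)
    | meet_elim_2 _ ih => exact .meet_elim_2 (ih hQ)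
    | _ => cases hQ
  | meet Q₁ Q₂ ihQ₁ ihQ₂ =>
    generalize hQ : Qual.meet Q₁ Q₂ = Q at h₂
    induction h₂ with
    | top => exact .top
    | join_intro_1 _ ih => exact .join_intro_1 (ih hQ)
    | join_intro_2 _ ih => exact .join_intro_2 (ih hQ)
    | meet_intro _ _ ih₁ ih₂ => exact .meet_intro (ih₁ hQ) (ih₂ hQ)
    | meet_elim_1 h => cases hQ; exact ihQ₁ h₁.to_meet.1 h
    | meet_elim_2 h => cases hQ; exact ihQ₂ h₁.to_meet.2 h
    | _ => cases hQ
  | join Q₁ Q₂ ihQ₁ ihQ₂ =>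
    generalize hQ : Qual.join Q₁ Q₂ = Q at h₁
    induction h₁ with
    | bot => exact .bot
    | var hl _ ih => exact .var hl (ih hQ)
    | tvar hl _ ih => exact .tvar hl (ih hQ)
    | join_elim _ _ ih₁ ih₂ => exact .join_elim (ih₁ hQ) (ih₂ hQ)
    | meet_elim_1 _ ih => exact .meet_elim_1 (ih hQ)
    | meet_elim_2 _ ih => exact .meet_elim_2 (ih hQ)
    | join_intro_1 h => cases hQ; exact ihQ₁ h h₂.of_join.1
    | join_intro_2 h => cases hQ; exact ihQ₂ h h₂.of_join.2
    | _ => cases hQ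

theorem SubQual.rename {s s' : Sig} {Γ : Ctx s} {Δ : Ctx s'} {ρ : Ren s s'} (hρ : ρ.Typed Γ Δ)
    {Q R : Qual s} (h : SubQual Γ Q R) : SubQual Δ (Q.rename ρ) (R.rename ρ) := by
  induction h with
  | top => exact .top
  | bot => exact .bot
  | refl_var => exact .refl_var
  | refl_tvar => exact .refl_tvar
  | var hl _ ih => exact .var ((hρ _ _).trans (congrArg (Binding.rename ρ) hl)) ih
  | tvar hl _ ih => exact .tvar ((hρ _ _).trans (congrArg (Binding.rename ρ) hl)) ih
  | join_elim _ _ ih₁ ih₂ => exact .join_elim ih₁ ih₂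
  | meet_elim_1 _ ih => exact .meet_elim_1 ih
  | meet_elim_2 _ ih => exact .meet_elim_2 ih
  | join_intro_1 _ ih => exact .join_intro_1 ih
  | join_intro_2 _ ih => exact .join_intro_2 ih
  | meet_intro _ _ ih₁ ih₂ => exact .meet_intro ih₁ ih₂

theorem SubQual.joinVars_iff {s : Sig} {Γ : Ctx s} {l : List (Var s .tm)} {R : Qual s} :
    SubQual Γ (joinVars l) R ↔ ∀ x ∈ l, SubQual Γ (.tvar x) R := by
  induction l with
  | nil => simpa [joinVars] using SubQual.bot
  | cons x l ih =>
    rw [List.forall_mem_cons, ← ih]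
    exact ⟨fun h => h.of_join, fun h => .join_elim h.1 h.2⟩

/-! ### Subtyping -/

theorem Sub.refl {k : TySort} {s : Sig} (T : Ty k s) : ∀ Γ : Ctx s, Sub Γ T T := by
  induction T with
  | top => exact fun _ => .top
  | var X => exact fun _ => .refl_var
  | arrow T₁ T₂ ih₁ ih₂ => exact fun Γ => .arrow (ih₁ Γ) (ih₂ _)
  | all S T ih₁ ih₂ => exact fun Γ => .all (ih₁ Γ) (ih₂ _)
  | qall Q T ih => exact fun Γ => .qall (.refl Q) (ih _)
  | qtype Q S ih => exact fun Γ => .qtype (.refl Q) (ih Γ)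

theorem Sub.rename {s : Sig} {Γ : Ctx s} {k : TySort} {T U : Ty k s} (h : Sub Γ T U) :
    ∀ {s' : Sig} {Δ : Ctx s'} {ρ : Ren s s'}, ρ.Typed Γ Δ → Sub Δ (T.rename ρ) (U.rename ρ) := by
  induction h with
  | top => exact fun _ => .top
  | refl_var => exact fun _ => .refl_var
  | var hl _ ih =>
    exact fun hρ => .var ((hρ _ _).trans (congrArg (Binding.rename _) hl)) (ih hρ)
  | arrow _ _ ih₁ ih₂ => exact fun hρ => .arrow (ih₁ hρ) (ih₂ (hρ.lift _))
  | all _ _ ih₁ ih₂ => exact fun hρ => .all (ih₁ hρ) (ih₂ (hρ.lift _))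
  | qall h _ ih => exact fun hρ => .qall (h.rename hρ) (ih (hρ.lift _))
  | qtype h _ ih => exact fun hρ => .qtype (h.rename hρ) (ih hρ)

/-! ### Substitutions that respect bounds -/

/-- `σ` respects the binding `b` of the variable `x`. For a type variable the condition is the one
that makes the rule `Sub.var` admissible after substitution, in every extension of `Δ`; for a
transitive subtyping relation it amounts to `Δ ⊢ σ X <: S[σ]`. -/
def TySubst.Respects {s s' : Sig} (σ : TySubst s s') (Δ : Ctx s') {k : Kind} (x : Var s k)
    (b : Binding k s) : Prop :=
  match k, x, b with
  | _, x, .tm (.qtype Q _) => SubQual Δ (σ.qtm x) (Q.subst σ)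
  | _, X, .ty S => ∀ {s'' : Sig} {Θ : Ctx s''} {ρ : Ren s' s''} {S' : STy s''}, ρ.Typed Δ Θ →
      Sub Θ ((S.subst σ).rename ρ) S' → Sub Θ ((σ.ty X).rename ρ) S'
  | _, Y, .qu Q => SubQual Δ (σ.qu Y) (Q.subst σ)

/-- `σ` respects the bounds recorded in `Γ`. -/
def TySubst.Typed {s s' : Sig} (σ : TySubst s s') (Γ : Ctx s) (Δ : Ctx s') : Prop :=
  ∀ k (x : Var s k), σ.Respects Δ x (Γ.lookup x)

theorem TySubst.Typed.respects {s s' : Sig} {σ : TySubst s s'} {Γ : Ctx s} {Δ : Ctx s'}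
    (h : σ.Typed Γ Δ) {k : Kind} {x : Var s k} {b : Binding k s} (hl : Γ.lookup x = b) :
    σ.Respects Δ x b := hl ▸ h k x

theorem TySubst.Typed.lift {s s' : Sig} {σ : TySubst s s'} {Γ : Ctx s} {Δ : Ctx s'}
    (h : σ.Typed Γ Δ) {j : Kind} (b : Binding j s) :
    σ.lift.Typed (Γ.cons b) (Δ.cons (b.subst σ)) := by
  intro k x
  cases x with
  | here =>
    cases b with
    | tm T =>
      cases T with
      | qtype Q S =>
        refine SubQual.tvar (Q := (Q.subst σ).rename Ren.weak) (S := (S.subst σ).rename Ren.weak)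
          rfl ?_
        rw [Qual.subst_weak_comm]
        exact .refl _
    | ty S =>
      intro s'' Θ ρ S' hρ hS
      refine .var (hρ _ _) ?_
      rw [Ty.subst_weak_comm] at hS
      exact hS
    | qu Q =>
      refine SubQual.var (Q := (Q.subst σ).rename Ren.weak) rfl ?_
      rw [Qual.subst_weak_comm]
      exact .refl _
  | there x =>
    have hx := h k x
    change σ.lift.Respects _ _ ((Γ.lookup x).rename Ren.weak)
    cases hb : Γ.lookup x with
    | tm T =>
      cases T with
      | qtype Q S =>
        rw [hb] at hx
        refine Eq.subst (motive := SubQual _ _) (Qual.subst_weak_comm σ Q).symm ?_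
        exact hx.rename (Ren.Typed.weak _ _)
    | ty S =>
      rw [hb] at hx
      intro s'' Θ ρ S' hρ hS
      rw [Ty.subst_weak_comm, Ty.rename_rename] at hS
      -- An extension of the lifted target environment is also an extension of `Δ`, by precomposing
      -- with weakening. Quantifying over all extensions in `Respects` makes it stable under
      -- binders.
      have := hx ((Ren.Typed.weak Δ (b.subst σ)).comp hρ) hS
      rw [← Ty.rename_rename] at this
      exact this
    | qu Q =>
      rw [hb] at hx
      refine Eq.subst (motive := SubQual _ _) (Qual.subst_weak_comm σ Q).symm ?_
      exact hx.rename (Ren.Typed.weak _ _)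

theorem TySubst.Typed.cons {s s' : Sig} {j : Kind} {σ : TySubst (j :: s) s'} {Γ : Ctx s}
    {Δ : Ctx s'} {b : Binding j s} (h : (σ.precomp Ren.weak).Typed Γ Δ)
    (hb : σ.Respects Δ .here (b.rename Ren.weak)) : σ.Typed (Γ.cons b) Δ := by
  intro k x
  cases x with
  | here => exact hb
  | there x =>
    have hx := h k x
    change σ.Respects _ _ ((Γ.lookup x).rename Ren.weak)
    cases hb : Γ.lookup x with
    | tm T =>
      cases T with
      | qtype Q S =>
        rw [hb] at hx
        exact Eq.subst (motive := SubQual _ _) (Qual.subst_rename _ σ Q).symm hx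
    | ty S =>
      rw [hb] at hx
      intro s'' Θ ρ S' hρ hS
      rw [Ty.subst_rename] at hS
      exact hx hρ hS
    | qu Q =>
      rw [hb] at hx
      exact Eq.subst (motive := SubQual _ _) (Qual.subst_rename _ σ Q).symm hx

theorem Ren.Typed.ofRen {s s' : Sig} {ρ : Ren s s'} {Γ : Ctx s} {Δ : Ctx s'} (h : ρ.Typed Γ Δ) :
    (TySubst.ofRen ρ).Typed Γ Δ := by
  intro k x
  have hx := h k x
  cases hb : Γ.lookup x with
  | tm T =>
    cases T with
    | qtype Q S =>
      rw [hb] at hx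
      refine SubQual.tvar hx ?_
      rw [Qual.rename_eq_subst]
      exact .refl _
  | ty S =>
    rw [hb] at hx
    intro s'' Θ ρ' S' hρ' hS
    refine Sub.var ((hρ' _ _).trans (congrArg (Binding.rename ρ') hx)) ?_
    rw [Ty.rename_eq_subst _ ρ]
    exact hS
  | qu Q =>
    rw [hb] at hx
    refine SubQual.var hx ?_
    rw [Qual.rename_eq_subst]
    exact .refl _

theorem TySubst.Typed.id {s : Sig} (Γ : Ctx s) : TySubst.id.Typed Γ Γ := (Ren.Typed.id Γ).ofRen

theorem SubQual.subst {s s' : Sig} {Γ : Ctx s} {Δ : Ctx s'} {σ : TySubst s s'}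
    (hσ : σ.Typed Γ Δ) {Q R : Qual s} (h : SubQual Γ Q R) :
    SubQual Δ (Q.subst σ) (R.subst σ) := by
  induction h with
  | top => exact .top
  | bot => exact .bot
  | refl_var => exact .refl _
  | refl_tvar => exact .refl _
  | var hl _ ih => exact SubQual.trans (hσ.respects hl) ih
  | tvar hl _ ih => exact SubQual.trans (hσ.respects hl) ih
  | join_elim _ _ ih₁ ih₂ => exact .join_elim ih₁ ih₂
  | meet_elim_1 _ ih => exact .meet_elim_1 ih
  | meet_elim_2 _ ih => exact .meet_elim_2 ih
  | join_intro_1 _ ih => exact .join_intro_1 ih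
  | join_intro_2 _ ih => exact .join_intro_2 ih
  | meet_intro _ _ ih₁ ih₂ => exact .meet_intro ih₁ ih₂

theorem Sub.subst {s : Sig} {Γ : Ctx s} {k : TySort} {T U : Ty k s} (h : Sub Γ T U) :
    ∀ {s' : Sig} {Δ : Ctx s'} {σ : TySubst s s'}, σ.Typed Γ Δ →
      Sub Δ (T.subst σ) (U.subst σ) := by
  induction h with
  | top => exact fun _ => .top
  | refl_var => exact fun _ => Sub.refl _ _
  | var hl _ ih =>
    intro s' Δ σ hσ
    -- `Respects` at the trivial extension replaces an appeal to transitivity, which is not yet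
    -- available.
    have := hσ.respects hl (Ren.Typed.id Δ) (by rw [Ty.rename_id]; exact ih hσ)
    rwa [Ty.rename_id] at this
  | arrow _ _ ih₁ ih₂ => exact fun hσ => .arrow (ih₁ hσ) (ih₂ (hσ.lift _))
  | all _ _ ih₁ ih₂ => exact fun hσ => .all (ih₁ hσ) (ih₂ (hσ.lift _))
  | qall h _ ih => exact fun hσ => .qall (h.subst hσ) (ih (hσ.lift _))
  | qtype h _ ih => exact fun hσ => .qtype (h.subst hσ) (ih hσ)

/-! ### Narrowing and transitivity of subtyping -/

theorem TySubst.Typed.narrow {s : Sig} {Γ : Ctx s} {j : Kind} {b b' : Binding j s}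
    (h : TySubst.id.Respects (Γ.cons b') .here (b.rename Ren.weak)) :
    TySubst.id.Typed (Γ.cons b) (Γ.cons b') :=
  .cons (Ren.Typed.weak Γ b').ofRen h

theorem Sub.narrow {s : Sig} {Γ : Ctx s} {j : Kind} {b b' : Binding j s} {k : TySort}
    {T U : Ty k (j :: s)} (h : TySubst.id.Respects (Γ.cons b') .here (b.rename Ren.weak))
    (hTU : Sub (Γ.cons b) T U) : Sub (Γ.cons b') T U := by
  have := hTU.subst (TySubst.Typed.narrow h)
  rwa [Ty.subst_id, Ty.subst_id] at this

/-- Subtyping consults a term variable only through its qualifier, so transitivity of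
subqualification suffices here, in contrast with type variables. -/
theorem Sub.narrow_tm {s : Sig} {Γ : Ctx s} {T₁ T₂ : QTy s} {k : TySort} {T U : Ty k (.tm :: s)}
    (h : Sub Γ T₂ T₁) (hTU : Sub (Γ.cons (.tm T₁)) T U) : Sub (Γ.cons (.tm T₂)) T U := by
  cases h with
  | qtype hQ hS =>
    refine hTU.narrow ?_
    refine SubQual.tvar (Γ := Γ.cons _) (x := .here) rfl ?_
    rw [Qual.subst_id]
    exact hQ.rename (Ren.Typed.weak _ _)

theorem Sub.narrow_qu {s : Sig} {Γ : Ctx s} {Q₁ Q₂ : Qual s} {k : TySort} {T U : Ty k (.qu :: s)}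
    (h : SubQual Γ Q₂ Q₁) (hTU : Sub (Γ.cons (.qu Q₁)) T U) : Sub (Γ.cons (.qu Q₂)) T U := by
  refine hTU.narrow ?_
  refine SubQual.var (Γ := Γ.cons _) (Y := .here) rfl ?_
  rw [Qual.subst_id]
  exact h.rename (Ren.Typed.weak _ _)

/-- Subtyping is transitive through every renaming of `T`. -/
def TransThrough {k : TySort} {s : Sig} (T : Ty k s) : Prop :=
  ∀ {s' : Sig} {Δ : Ctx s'} {ρ : Ren s s'} {A B : Ty k s'},
    Sub Δ A (T.rename ρ) → Sub Δ (T.rename ρ) B → Sub Δ A B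

/-- The old bound is a renaming of a fixed type `S`. Under further binders it is still a renaming of
`S`, so transitivity through `S` alone is enough; this is why `TransThrough` ranges over renamings.
-/
theorem Sub.narrow_ty {s s₀ : Sig} {Γ : Ctx s} {S : STy s₀} {ρ : Ren s₀ s} {S₂ : STy s}
    {k : TySort} {T U : Ty k (.ty :: s)} (hS : TransThrough S)
    (h : Sub Γ S₂ (S.rename ρ)) (hTU : Sub (Γ.cons (.ty (S.rename ρ))) T U) :
    Sub (Γ.cons (.ty S₂)) T U := by
  refine hTU.narrow ?_
  intro s'' Θ ρ' S' hρ' hS'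
  rw [Ty.subst_id, Ty.rename_rename, Ty.rename_rename] at hS'
  refine Sub.var (hρ' _ _) ?_
  refine hS ?_ hS'
  have := (h.rename (Ren.Typed.weak Γ (.ty S₂))).rename hρ'
  rw [Ty.rename_rename _ _ S, Ty.rename_rename _ _ S] at this
  exact this

def Ty.IsVar {k : TySort} {s : Sig} : Ty k s → Prop
  | .var _ => True
  | _ => False

def Ty.IsTop {k : TySort} {s : Sig} : Ty k s → Prop
  | .top => True
  | _ => False

/-- To replace the right-hand side of a subtyping, one may first unfold the bounds of the variables
that the rule `Sub.var` has introduced on the left. -/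
theorem Sub.unfold_bounds {s : Sig} {Γ : Ctx s} {k : TySort} {A M B : Ty k s} (h : Sub Γ A M)
    (hM : ¬ M.IsTop) (hB : ∀ A', Sub Γ A' M → (A'.IsVar → A' = M) → Sub Γ A' B) : Sub Γ A B := by
  induction h with
  | top => exact (hM trivial).elim
  | refl_var => exact hB _ .refl_var fun _ => rfl
  | var hl _ ih => exact .var hl (ih hM hB)
  | arrow h₁ h₂ => exact hB _ (.arrow h₁ h₂) nofun
  | all h₁ h₂ => exact hB _ (.all h₁ h₂) nofun
  | qall h₁ h₂ => exact hB _ (.qall h₁ h₂) nofun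
  | qtype h₁ h₂ => exact hB _ (.qtype h₁ h₂) nofun

theorem transThrough {k : TySort} {s : Sig} (T : Ty k s) : TransThrough T := by
  induction T with
  | top =>
    intro s' Δ ρ A B h₁ h₂
    cases h₂
    exact .top
  | var X =>
    intro s' Δ ρ A B h₁ h₂
    refine h₁.unfold_bounds (by exact not_false) ?_
    intro A' hA' hv
    cases hA' with
    | refl_var => exact h₂
    | var hl h => exact hv trivial ▸ h₂
  | arrow T₁ T₂ ih₁ ih₂ =>
    intro s' Δ ρ A B h₁ h₂
    refine h₁.unfold_bounds (by exact not_false) ?_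
    intro A' hA' hv
    cases hA' with
    | var => cases hv trivial
    | arrow h₁₁ h₁₂ =>
      cases h₂ with
      | top => exact .top
      | arrow h₂₁ h₂₂ => exact .arrow (ih₁ h₂₁ h₁₁) (ih₂ (h₂₁.narrow_tm h₁₂) h₂₂)
  | all S T ih₁ ih₂ =>
    intro s' Δ ρ A B h₁ h₂
    refine h₁.unfold_bounds (by exact not_false) ?_
    intro A' hA' hv
    cases hA' with
    | var => cases hv trivial
    | all h₁₁ h₁₂ =>
      cases h₂ with
      | top => exact .top
      -- The two bodies are compared under different bounds. Narrowing to the smaller bound costs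
      -- transitivity at `S`, which is the induction hypothesis `ih₁`.
      | all h₂₁ h₂₂ => exact .all (ih₁ h₂₁ h₁₁) (ih₂ (Sub.narrow_ty ih₁ h₂₁ h₁₂) h₂₂)
  | qall Q T ih =>
    intro s' Δ ρ A B h₁ h₂
    refine h₁.unfold_bounds (by exact not_false) ?_
    intro A' hA' hv
    cases hA' with
    | var => cases hv trivial
    | qall h₁₁ h₁₂ =>
      cases h₂ with
      | top => exact .top
      | qall h₂₁ h₂₂ => exact .qall (h₂₁.trans h₁₁) (ih (Sub.narrow_qu h₂₁ h₁₂) h₂₂)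
  | qtype Q S ih =>
    intro s' Δ ρ A B h₁ h₂
    cases h₁ with
    | qtype h₁₁ h₁₂ =>
      cases h₂ with
      | qtype h₂₁ h₂₂ => exact .qtype (h₁₁.trans h₂₁) (ih h₁₂ h₂₂)

theorem Sub.trans {s : Sig} {Γ : Ctx s} {k : TySort} {A T B : Ty k s} (h₁ : Sub Γ A T)
    (h₂ : Sub Γ T B) : Sub Γ A B :=
  transThrough T (ρ := fun _ x => x) (by rwa [Ty.rename_id]) (by rwa [Ty.rename_id])

/-! ### Instantiating the innermost binder -/

theorem TySubst.Typed.instTm {s : Sig} {Γ : Ctx s} {Q Q' : Qual s} {S : STy s}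
    (h : SubQual Γ Q' Q) : (TySubst.instTm Q').Typed (Γ.cons (.tm (.qtype Q S))) Γ := by
  refine .cons (TySubst.Typed.id Γ) ?_
  exact Eq.subst (motive := SubQual _ _) (Qual.weak_instTm _ _).symm h

theorem TySubst.Typed.instTy {s : Sig} {Γ : Ctx s} {S S' : STy s}
    (h : Sub Γ S' S) : (TySubst.instTy S').Typed (Γ.cons (.ty S)) Γ := by
  refine .cons (TySubst.Typed.id Γ) ?_
  intro s'' Θ ρ U hρ hU
  rw [Ty.weak_instTy] at hU
  exact (h.rename hρ).trans hU

theorem TySubst.Typed.instQu {s : Sig} {Γ : Ctx s} {Q Q' : Qual s}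
    (h : SubQual Γ Q' Q) : (TySubst.instQu Q').Typed (Γ.cons (.qu Q)) Γ := by
  refine .cons (TySubst.Typed.id Γ) ?_
  exact Eq.subst (motive := SubQual _ _) (Qual.weak_instQu _ _).symm h

/-! ### Free variables -/

theorem Var.mem_filterMap_lower {s : Sig} {j : Kind} {l : List (Var (j :: s) .tm)}
    {x : Var s .tm} : x ∈ l.filterMap Var.lower ↔ Var.there x ∈ l := by
  rw [List.mem_filterMap]
  constructor
  · rintro ⟨y, hy, h⟩
    cases y with
    | here => cases h
    | there y => cases h; exact hy
  · exact fun h => ⟨_, h, rfl⟩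

theorem Tm.mem_fv_rename {s : Sig} (t : Tm s) :
    ∀ {s' : Sig} {ρ : Ren s s'} {y : Var s' .tm}, y ∈ (t.rename ρ).fv →
      ∃ x ∈ t.fv, y = ρ _ x := by
  have binder {s s' : Sig} {j : Kind} {t : Tm (j :: s)} {ρ : Ren s s'} {y : Var s' .tm}
      (ih : ∃ x ∈ t.fv, Var.there y = ρ.lift _ x) :
      ∃ x ∈ t.fv.filterMap Var.lower, y = ρ _ x := by
    obtain ⟨x, hx, h⟩ := ih
    cases x with
    | here => cases h
    | there x => cases h; exact ⟨x, Var.mem_filterMap_lower.2 hx, rfl⟩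
  induction t with
  | var x =>
    intro s' ρ y hy
    exact ⟨x, List.mem_singleton_self x, List.mem_singleton.1 hy⟩
  | lam _ _ ih => exact fun hy => binder (ih (Var.mem_filterMap_lower.1 hy))
  | tlam _ _ _ ih => exact fun hy => binder (ih (Var.mem_filterMap_lower.1 hy))
  | qlam _ _ _ ih => exact fun hy => binder (ih (Var.mem_filterMap_lower.1 hy))
  | app _ _ _ ih₁ ih₂ =>
    intro s' ρ y hy
    rcases List.mem_append.1 hy with hy | hy
    · obtain ⟨x, hx, h⟩ := ih₁ hy
      exact ⟨x, List.mem_append_left _ hx, h⟩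
    · obtain ⟨x, hx, h⟩ := ih₂ hy
      exact ⟨x, List.mem_append_right _ hx, h⟩
  | tapp _ _ ih => exact fun hy => ih hy
  | qapp _ _ ih => exact fun hy => ih hy
  | assert _ _ ih => exact fun hy => ih hy
  | upqual _ _ ih => exact fun hy => ih hy

theorem Tm.mem_fv_subst {s : Sig} (t : Tm s) :
    ∀ {s' : Sig} {σ : TySubst s s'} {τ : TmSubst s s'} {y : Var s' .tm}, y ∈ (t.subst σ τ).fv →
      ∃ x ∈ t.fv, y ∈ (τ x).fv := by
  have binder {s s' : Sig} {j : Kind} {t : Tm (j :: s)} {τ : TmSubst s s'} {y : Var s' .tm}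
      (ih : ∃ x ∈ t.fv, Var.there y ∈ (τ.lift x).fv) :
      ∃ x ∈ t.fv.filterMap Var.lower, y ∈ (τ x).fv := by
    obtain ⟨x, hx, h⟩ := ih
    cases x with
    | here => cases List.mem_singleton.1 h
    -- A free variable of a weakened term is itself weakened, so the occurrence of `y` descends to
    -- `τ x`.
    | there x =>
      obtain ⟨z, hz, h⟩ := Tm.mem_fv_rename _ h
      cases h
      exact ⟨x, Var.mem_filterMap_lower.2 hx, hz⟩
  induction t with
  | var x =>
    intro s' σ τ y hy
    exact ⟨x, List.mem_singleton_self x, hy⟩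
  | lam _ _ ih => exact fun hy => binder (ih (Var.mem_filterMap_lower.1 hy))
  | tlam _ _ _ ih => exact fun hy => binder (ih (Var.mem_filterMap_lower.1 hy))
  | qlam _ _ _ ih => exact fun hy => binder (ih (Var.mem_filterMap_lower.1 hy))
  | app _ _ _ ih₁ ih₂ =>
    intro s' σ τ y hy
    rcases List.mem_append.1 hy with hy | hy
    · obtain ⟨x, hx, h⟩ := ih₁ hy
      exact ⟨x, List.mem_append_left _ hx, h⟩
    · obtain ⟨x, hx, h⟩ := ih₂ hy
      exact ⟨x, List.mem_append_right _ hx, h⟩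
  | tapp _ _ ih => exact fun hy => ih hy
  | qapp _ _ ih => exact fun hy => ih hy
  | assert _ _ ih => exact fun hy => ih hy
  | upqual _ _ ih => exact fun hy => ih hy

theorem SubQual.joinVars_fv_rename {s s' : Sig} {Γ : Ctx s} {Δ : Ctx s'} {ρ : Ren s s'}
    (hρ : ρ.Typed Γ Δ) {t : Tm s} {P : Qual s} (h : SubQual Γ (joinVars t.fv) P) :
    SubQual Δ (joinVars (t.rename ρ).fv) (P.rename ρ) := by
  rw [SubQual.joinVars_iff] at h ⊢
  intro y hy
  obtain ⟨x, hx, rfl⟩ := t.mem_fv_rename hy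
  exact (h x hx).rename hρ

/-! ### Typing -/

theorem HasType.rename {s : Sig} {Γ : Ctx s} {t : Tm s} {T : QTy s} (h : HasType Γ t T) :
    ∀ {s' : Sig} {Δ : Ctx s'} {ρ : Ren s s'}, ρ.Typed Γ Δ →
      HasType Δ (t.rename ρ) (T.rename ρ) := by
  induction h with
  | var hl => exact fun hρ => .var ((hρ _ _).trans (congrArg (Binding.rename _) hl))
  | abs _ hP ih => exact fun hρ => .abs (ih (hρ.lift _)) (hP.joinVars_fv_rename hρ)
  | t_abs _ hP ih => exact fun hρ => .t_abs (ih (hρ.lift _)) (hP.joinVars_fv_rename hρ)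
  | q_abs _ hP ih => exact fun hρ => .q_abs (ih (hρ.lift _)) (hP.joinVars_fv_rename hρ)
  | app _ _ hQ ih₁ ih₂ =>
    intro s' Δ ρ hρ
    rw [Ty.rename_instTm]
    exact .app (ih₁ hρ) (ih₂ hρ) (hQ.rename hρ)
  | t_app _ hS ih =>
    intro s' Δ ρ hρ
    rw [Ty.rename_instTy]
    exact .t_app (ih hρ) (hS.rename hρ)
  | q_app _ hQ ih =>
    intro s' Δ ρ hρ
    rw [Ty.rename_instQu]
    exact .q_app (ih hρ) (hQ.rename hρ)
  | assert _ hQ ih => exact fun hρ => .assert (ih hρ) (hQ.rename hρ)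
  | upqual _ hQ ih => exact fun hρ => .upqual (ih hρ) (hQ.rename hρ)
  | sub _ hT ih => exact fun hρ => .sub (ih hρ) (hT.rename hρ)

/-- The term component of a substitution is typed: `τ x` has the type recorded for `x` with
qualifier `σ x`, and `σ x` is above the free variables of `τ x`. -/
structure TmSubst.Typed {s s' : Sig} (τ : TmSubst s s') (σ : TySubst s s') (Γ : Ctx s)
    (Δ : Ctx s') : Prop where
  hasType : ∀ {x : Var s .tm} {Q : Qual s} {S : STy s}, Γ.lookup x = .tm (.qtype Q S) →
    HasType Δ (τ x) (.qtype (σ.qtm x) (S.subst σ))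
  fv : ∀ x, SubQual Δ (joinVars (τ x).fv) (σ.qtm x)

theorem SubQual.joinVars_singleton {s : Sig} {Γ : Ctx s} (x : Var s .tm) :
    SubQual Γ (joinVars [x]) (.tvar x) := .join_elim .refl_tvar .bot

theorem TmSubst.Typed.lift {s s' : Sig} {τ : TmSubst s s'} {σ : TySubst s s'} {Γ : Ctx s}
    {Δ : Ctx s'} (h : τ.Typed σ Γ Δ) {j : Kind} (b : Binding j s) :
    (TmSubst.lift τ).Typed σ.lift (Γ.cons b) (Δ.cons (b.subst σ)) where
  hasType {x Q S} hl := by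
    cases x with
    | here =>
      cases b with
      | tm T =>
        cases T with
        | qtype Q₀ S₀ =>
          cases hl
          rw [Ty.subst_weak_comm]
          exact .var (Γ := Δ.cons _) (x := .here) rfl
    | there x =>
      change (Γ.lookup x).rename Ren.weak = _ at hl
      cases hT : Γ.lookup x with
      | tm T =>
        cases T with
        | qtype Q₀ S₀ =>
          rw [hT] at hl
          cases hl
          rw [Ty.subst_weak_comm]
          exact (h.hasType hT).rename (Ren.Typed.weak Δ (b.subst σ))
  fv x := by
    cases x with
    | here => exact .joinVars_singleton _
    | there x => exact (h.fv x).joinVars_fv_rename (Ren.Typed.weak Δ (b.subst σ))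

/-- A free variable `y` of the substituted term comes from some `τ x` with `x` free in `t`. Then `y
<: σ x` because `τ` is typed, and `σ x <: P[σ]` by substituting into `x <: P`. -/
theorem SubQual.joinVars_fv_subst {s s' : Sig} {Γ : Ctx s} {Δ : Ctx s'} {σ : TySubst s s'}
    {τ : TmSubst s s'} (hσ : σ.Typed Γ Δ) (hτ : τ.Typed σ Γ Δ) {t : Tm s} {P : Qual s}
    (h : SubQual Γ (joinVars t.fv) P) : SubQual Δ (joinVars (t.subst σ τ).fv) (P.subst σ) := by
  rw [SubQual.joinVars_iff] at h ⊢
  intro y hy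
  obtain ⟨x, hx, hy⟩ := t.mem_fv_subst hy
  exact (SubQual.joinVars_iff.1 (hτ.fv x) y hy).trans ((h x hx).subst hσ)

theorem HasType.subst {s : Sig} {Γ : Ctx s} {t : Tm s} {T : QTy s} (h : HasType Γ t T) :
    ∀ {s' : Sig} {Δ : Ctx s'} {σ : TySubst s s'} {τ : TmSubst s s'}, σ.Typed Γ Δ →
      τ.Typed σ Γ Δ → HasType Δ (t.subst σ τ) (T.subst σ) := by
  induction h with
  -- The typing rule gives `x` the qualifier `x` rather than its bound, so the required qualifier is
  -- exactly `σ x`.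
  | var hl => exact fun _ hτ => hτ.hasType hl
  | abs _ hP ih =>
    exact fun hσ hτ => .abs (ih (hσ.lift _) (hτ.lift _)) (hP.joinVars_fv_subst hσ hτ)
  | t_abs _ hP ih =>
    exact fun hσ hτ => .t_abs (ih (hσ.lift _) (hτ.lift _)) (hP.joinVars_fv_subst hσ hτ)
  | q_abs _ hP ih =>
    exact fun hσ hτ => .q_abs (ih (hσ.lift _) (hτ.lift _)) (hP.joinVars_fv_subst hσ hτ)
  | app _ _ hQ ih₁ ih₂ =>
    intro s' Δ σ τ hσ hτ
    rw [Ty.subst_instTm]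
    exact .app (ih₁ hσ hτ) (ih₂ hσ hτ) (hQ.subst hσ)
  | t_app _ hS ih =>
    intro s' Δ σ τ hσ hτ
    rw [Ty.subst_instTy]
    exact .t_app (ih hσ hτ) (hS.subst hσ)
  | q_app _ hQ ih =>
    intro s' Δ σ τ hσ hτ
    rw [Ty.subst_instQu]
    exact .q_app (ih hσ hτ) (hQ.subst hσ)
  | assert _ hQ ih => exact fun hσ hτ => .assert (ih hσ hτ) (hQ.subst hσ)
  | upqual _ hQ ih => exact fun hσ hτ => .upqual (ih hσ hτ) (hQ.subst hσ)
  | sub _ hT ih => exact fun hσ hτ => .sub (ih hσ hτ) (hT.subst hσ)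

/-! ### Inversion of typing for abstractions -/

/-- Transitivity collapses all trailing uses of subsumption into one. -/
theorem HasType.lam_inv {s : Sig} {Γ : Ctx s} {P : Qual s} {t : Tm (.tm :: s)} {T : QTy s}
    (h : HasType Γ (.lam P t) T) :
    ∃ T₁ T₂, HasType (Γ.cons (.tm T₁)) t T₂ ∧ SubQual Γ (joinVars (Tm.lam P t).fv) P ∧
      Sub Γ (.qtype P (.arrow T₁ T₂)) T := by
  generalize hu : Tm.lam P t = u at h
  induction h with
  | abs ht hP => cases hu; exact ⟨_, _, ht, hP, Sub.refl _ _⟩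
  | sub _ hT ih =>
    obtain ⟨T₁, T₂, ht, hP, hT'⟩ := ih hu
    exact ⟨T₁, T₂, ht, hP, hT'.trans hT⟩
  | _ => cases hu

theorem HasType.tlam_inv {s : Sig} {Γ : Ctx s} {P : Qual s} {S : STy s} {t : Tm (.ty :: s)}
    {T : QTy s} (h : HasType Γ (.tlam P S t) T) :
    ∃ T₂, HasType (Γ.cons (.ty S)) t T₂ ∧ SubQual Γ (joinVars (Tm.tlam P S t).fv) P ∧
      Sub Γ (.qtype P (.all S T₂)) T := by
  generalize hu : Tm.tlam P S t = u at h
  induction h with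
  | t_abs ht hP => cases hu; exact ⟨_, ht, hP, Sub.refl _ _⟩
  | sub _ hT ih =>
    obtain ⟨T₂, ht, hP, hT'⟩ := ih hu
    exact ⟨T₂, ht, hP, hT'.trans hT⟩
  | _ => cases hu

theorem HasType.qlam_inv {s : Sig} {Γ : Ctx s} {P Q : Qual s} {t : Tm (.qu :: s)}
    {T : QTy s} (h : HasType Γ (.qlam P Q t) T) :
    ∃ T₂, HasType (Γ.cons (.qu Q)) t T₂ ∧ SubQual Γ (joinVars (Tm.qlam P Q t).fv) P ∧
      Sub Γ (.qtype P (.qall Q T₂)) T := by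
  generalize hu : Tm.qlam P Q t = u at h
  induction h with
  | q_abs ht hP => cases hu; exact ⟨_, ht, hP, Sub.refl _ _⟩
  | sub _ hT ih =>
    obtain ⟨T₂, ht, hP, hT'⟩ := ih hu
    exact ⟨T₂, ht, hP, hT'.trans hT⟩
  | _ => cases hu

/-- The qualifier of a typed value is above the free variables of the value. -/
theorem HasType.value_fv {s : Sig} {Γ : Ctx s} {v : Tm s} {P Q : Qual s} {S : STy s}
    (hv : Value P v) (h : HasType Γ v (.qtype Q S)) : SubQual Γ (joinVars v.fv) Q := by
  cases hv with
  | lam =>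
    obtain ⟨_, _, _, hP, hT⟩ := h.lam_inv
    cases hT with
    | qtype hQ _ => exact hP.trans hQ
  | tlam =>
    obtain ⟨_, _, hP, hT⟩ := h.tlam_inv
    cases hT with
    | qtype hQ _ => exact hP.trans hQ
  | qlam =>
    obtain ⟨_, _, hP, hT⟩ := h.qlam_inv
    cases hT with
    | qtype hQ _ => exact hP.trans hQ

/-- The abstraction rule applies again with the new tag, since the free variables lie below `Q` and
`Q <: R`; the simple type is untouched. -/
theorem HasType.retag {s : Sig} {Γ : Ctx s} {v : Tm s} {P Q R : Qual s} {S : STy s}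
    (hv : Value P v) (h : HasType Γ v (.qtype Q S)) (hR : SubQual Γ Q R) :
    HasType Γ (v.retag R) (.qtype R S) := by
  have hfv := (h.value_fv hv).trans hR
  cases hv with
  | lam =>
    obtain ⟨_, _, ht, _, hT⟩ := h.lam_inv
    cases hT with
    | qtype _ hS => exact .sub (.abs ht hfv) (.qtype (.refl _) hS)
  | tlam =>
    obtain ⟨_, ht, _, hT⟩ := h.tlam_inv
    cases hT with
    | qtype _ hS => exact .sub (.t_abs ht hfv) (.qtype (.refl _) hS)
  | qlam =>
    obtain ⟨_, ht, _, hT⟩ := h.qlam_inv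
    cases hT with
    | qtype _ hS => exact .sub (.q_abs ht hfv) (.qtype (.refl _) hS)

/-! ### Typing of instantiated bodies -/

theorem HasType.instTm {s : Sig} {Γ : Ctx s} {t : Tm (.tm :: s)} {v : Tm s} {Q Q' : Qual s}
    {S : STy s} {T : QTy (.tm :: s)} (ht : HasType (Γ.cons (.tm (.qtype Q S))) t T)
    (hv : HasType Γ v (.qtype Q' S)) (hfv : SubQual Γ (joinVars v.fv) Q') (hQ : SubQual Γ Q' Q) :
    HasType Γ (t.instTm Q' v) (T.subst (TySubst.instTm Q')) := by
  refine ht.subst (TySubst.Typed.instTm hQ) ⟨?_, ?_⟩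
  · intro x Q₀ S₀ hl
    cases x with
    | here =>
      cases hl
      rw [Ty.weak_instTm]
      exact hv
    | there x =>
      change (Γ.lookup x).rename Ren.weak = _ at hl
      cases hT : Γ.lookup x with
      | tm T =>
        cases T with
        | qtype Q₁ S₁ =>
          rw [hT] at hl
          cases hl
          rw [Ty.weak_instTm]
          exact .var hT
  · intro x
    cases x with
    | here => exact hfv
    | there x => exact .joinVars_singleton x

theorem HasType.instTy {s : Sig} {Γ : Ctx s} {t : Tm (.ty :: s)} {S S' : STy s}
    {T : QTy (.ty :: s)} (ht : HasType (Γ.cons (.ty S)) t T) (hS : Sub Γ S' S) :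
    HasType Γ (t.instTy S') (T.subst (TySubst.instTy S')) := by
  refine ht.subst (TySubst.Typed.instTy hS) ⟨?_, ?_⟩
  · intro x Q₀ S₀ hl
    cases x with
    | there x =>
      change (Γ.lookup x).rename Ren.weak = _ at hl
      cases hT : Γ.lookup x with
      | tm T =>
        cases T with
        | qtype Q₁ S₁ =>
          rw [hT] at hl
          cases hl
          rw [Ty.weak_instTy]
          exact .var hT
  · intro x
    cases x with
    | there x => exact .joinVars_singleton x

theorem HasType.instQu {s : Sig} {Γ : Ctx s} {t : Tm (.qu :: s)} {Q Q' : Qual s}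
    {T : QTy (.qu :: s)} (ht : HasType (Γ.cons (.qu Q)) t T) (hQ : SubQual Γ Q' Q) :
    HasType Γ (t.instQu Q') (T.subst (TySubst.instQu Q')) := by
  refine ht.subst (TySubst.Typed.instQu hQ) ⟨?_, ?_⟩
  · intro x Q₀ S₀ hl
    cases x with
    | there x =>
      change (Γ.lookup x).rename Ren.weak = _ at hl
      cases hT : Γ.lookup x with
      | tm T =>
        cases T with
        | qtype Q₁ S₁ =>
          rw [hT] at hl
          cases hl
          rw [Ty.weak_instQu]
          exact .var hT
  · intro x
    cases x with
    | there x => exact .joinVars_singleton x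

/-! ### Preservation -/

theorem HasType.preservation {s : Sig} {Γ : Ctx s} {t : Tm s} {T : QTy s} (h : HasType Γ t T) :
    ∀ {t' : Tm s}, Step t t' → HasType Γ t' T := by
  induction h with
  | var => exact nofun
  | abs => exact nofun
  | t_abs => exact nofun
  | q_abs => exact nofun
  | app ht hu hQ iht ihu =>
    intro t' hst
    cases hst with
    | beta_v hv =>
      obtain ⟨T₁, T₂, hb, _, hT⟩ := ht.lam_inv
      cases hT with
      | qtype _ hT =>
        cases hT with
        | arrow h₁ h₂ =>
          cases h₁ with
          | qtype hQ₁ hS₁ =>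
            -- The body is typed under the abstraction's own domain `{Q₁} S₁`. The argument is
            -- subsumed to `S₁` with its qualifier kept at exactly `Q'`, and `Q' <: Q <: Q₁`. The
            -- result types are compared under the other domain `{Q} S`.
            refine .sub (hb.instTm (hu.sub (.qtype (.refl _) hS₁)) (hu.value_fv hv)
              (hQ.trans hQ₁)) ?_
            exact h₂.subst (TySubst.Typed.instTm hQ)
    | app_fun hst => exact .app (iht hst) hu hQ
    -- The result type depends on the annotation `Q'`, not on the argument, so it survives a step of
    -- the argument.
    | app_arg _ hst => exact .app ht (ihu hst) hQ
  | t_app ht hS ih =>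
    intro t' hst
    cases hst with
    | beta_T =>
      obtain ⟨T₂, hb, _, hT⟩ := ht.tlam_inv
      cases hT with
      | qtype _ hT =>
        cases hT with
        | all h₁ h₂ =>
          exact .sub (hb.instTy (hS.trans h₁)) (h₂.subst (TySubst.Typed.instTy hS))
    | tapp hst => exact .t_app (ih hst) hS
  | q_app ht hQ ih =>
    intro t' hst
    cases hst with
    | beta_Q =>
      obtain ⟨T₂, hb, _, hT⟩ := ht.qlam_inv
      cases hT with
      | qtype _ hT =>
        cases hT with
        | qall h₁ h₂ =>
          exact .sub (hb.instQu (hQ.trans h₁)) (h₂.subst (TySubst.Typed.instQu hQ))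
    | qapp hst => exact .q_app (ih hst) hQ
  | assert ht hQ ih =>
    intro t' hst
    cases hst with
    | assert => exact ht
    | assert_ctx hst => exact .assert (ih hst) hQ
  | upqual ht hQ ih =>
    intro t' hst
    cases hst with
    | upqual hv => exact ht.retag hv hQ
    | upqual_ctx hst => exact .upqual (ih hst) hQ
  | sub _ hT ih => exact fun hst => .sub (ih hst) hT

end FsubC

theorem mainTheorem9 {σ : FsubC.Sig} (Γ : FsubC.Ctx σ) (s t : FsubC.Tm σ) (T : FsubC.QTy σ)
    (hs : FsubC.HasType Γ s T) (hst : FsubC.Step s t) : FsubC.HasType Γ t T :=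
  hs.preservation hst
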